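/- Let $G=\operatorname{Aff}_+(\mathbb R)=\{(x,y)\in\mathbb R^2 \mid y>0\}$ with the product $(x_2,y_2)\cdot(x_1,y_1)=(x_2+y_2x_1,\,y_2y_1)$, identity $\operatorname{Id}=(0,1)$, and left-invariant frame $X_1=y\,\partial_x$, $X_2=y\,\partial_y$. Let $A=\begin{pmatrix}a&b\\c&d\end{pmatrix}$ be a real matrix with $\det A>0$ and $a\ge 0$, and write $A^{-1}=\begin{pmatrix}\alpha&\beta\\ \gamma&\delta\end{pmatrix}$. Equip $G$ with the left-invariant Lorentzian metric $$g(u_1X_1+u_2X_2)=-(au_1+bu_2)^2+(cu_1+du_2)^2,$$ time-oriented by the timelike left-invariant field $Y_1=\alpha X_1+\gamma X_2$. A future directed nonspacelike curve is a Lipschitz curve $q:[0,t_1]\to G$, $t_1\ge 0$, with $g(\dot q)\le 0$ and $g(\dot q,Y_1)<0$ almost everywhere; its length is $\int_0^{t_1}|g(\dot q,\dot q)|^{1/2}\,dt$. Let $J^+\subset G$ be the set of points that can be reached from $\operatorname{Id}$ by such curves, and for $q_1\in G$ let $d(q_1)\in[0,+\infty]$ be the supremum of the lengths of such curves from $\operatorname{Id}$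 to $q_1$ (and $d(q_1)=0$ if there are none). Assume that the sectional curvature $K$ of $(G,g)$ vanishes identically. Then: 1. If $q_1\notin J^+$, then $d(q_1)=0$. 2. If $q_1\in\partial J^+$, then $d(q_1)=0$. 3. $\gamma\neq 0$, and with $s_1=\operatorname{sgn}\gamma$, $$f=-\frac{\alpha-s_1\beta}{2\gamma},\qquad g_*=-\frac{\alpha+s_1\beta}{2\gamma},$$ one has $f\ne 0$. If $q_1=(x_1,y_1)\in\operatorname{int}J^+$, then $y_1\neq 1$, and with $$w=\frac{x_1-g_*(1-y_1)}{f},\qquad \tau=\sqrt{\frac{w}{y_1-y_1^2}},\qquad \rho=\sqrt{\frac{w\,y_1}{1-y_1}}$$ both radicands are positive and $$d(q_1)=\frac{\rho-\tau}{\gamma}\in(0,+\infty).$$ Moreover $d(\operatorname{int}J^+)=(0,+\infty)$. -/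

import Mathlib

open Set MeasureTheory
open scoped ENNReal

noncomputable section

/-- The group `Aff₊(ℝ)` of proper affine functions `s ↦ y * s + x`, `y > 0`, of the line, as the
open upper half-plane of pairs `(x, y)`. -/
abbrev AffPlus : Type := {q : ℝ × ℝ // 0 < q.2}

namespace AffPlus

/-- The identity function `(x, y) = (0, 1)`. -/
def Id : AffPlus := ⟨(0, 1), one_pos⟩

/-- The product given by composition: `(x₂, y₂) * (x₁, y₁) = (x₂ + y₂ x₁, y₂ y₁)`. -/
def mul (p q : AffPlus) : AffPlus :=
  ⟨(p.1.1 + p.1.2 * q.1.1, p.1.2 * q.1.2), mul_pos p.2 q.2⟩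

/-- The value at `q` of the left-invariant vector field `u₁ X₁ + u₂ X₂`, where
`X₁ = y ∂/∂x` and `X₂ = y ∂/∂y`. -/
def leftInvField (u q : ℝ × ℝ) : ℝ × ℝ := (q.2 * u.1, q.2 * u.2)

/-- The components `(u₁, u₂)` of a tangent vector `ξ` at `q` in the frame `X₁, X₂`. -/
def frameCoord (q ξ : ℝ × ℝ) : ℝ × ℝ := (ξ.1 / q.2, ξ.2 / q.2)

/-- The bilinear form on the Lie algebra of the quadratic form
`g(u) = -(a u₁ + b u₂)² + (c u₁ + d u₂)²`, where `A = !![a, b; c, d]`. -/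
def lieForm (A : Matrix (Fin 2) (Fin 2) ℝ) (u w : ℝ × ℝ) : ℝ :=
  -((A 0 0 * u.1 + A 0 1 * u.2) * (A 0 0 * w.1 + A 0 1 * w.2))
    + (A 1 0 * u.1 + A 1 1 * u.2) * (A 1 0 * w.1 + A 1 1 * w.2)

/-- The left-invariant Lorentzian metric at the point `q`, on tangent vectors written in the
coordinates `x, y`. -/
def metric (A : Matrix (Fin 2) (Fin 2) ℝ) (q ξ η : ℝ × ℝ) : ℝ :=
  lieForm A (frameCoord q ξ) (frameCoord q η)

/-- The left-invariant time orientation `Y₁ = α X₁ + γ X₂`, where `A⁻¹ = !![α, β; γ, δ]`;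
the form `g(Y₁, ·)` is `-(a u₁ + b u₂)`. -/
def timeOrientation (A : Matrix (Fin 2) (Fin 2) ℝ) (q : ℝ × ℝ) : ℝ × ℝ :=
  leftInvField (A⁻¹ 0 0, A⁻¹ 1 0) q

/-- The metric is invariant under the left translations `q ↦ p * q`, whose differential is the
multiplication by `p.1.2`. -/
theorem metric_mul (A : Matrix (Fin 2) (Fin 2) ℝ) (p q : AffPlus) (ξ η : ℝ × ℝ) :
    metric A (mul p q).1 (p.1.2 • ξ) (p.1.2 • η) = metric A q.1 ξ η := by
  have hp := p.2.ne'
  simp only [metric, frameCoord, mul, Prod.smul_fst, Prod.smul_snd, smul_eq_mul,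
    mul_div_mul_left _ _ hp]

/-! ### Sectional curvature, in the chart `(x, y)` -/

/-- Coordinate vectors `∂₀ = ∂/∂x`, `∂₁ = ∂/∂y`. -/
def coordVec (i : Fin 2) : ℝ × ℝ := if i = 0 then (1, 0) else (0, 1)

/-- Partial derivatives. -/
def partialD (i : Fin 2) (f : ℝ × ℝ → ℝ) (q : ℝ × ℝ) : ℝ := lineDeriv ℝ f q (coordVec i)

/-- The Gram matrix of the metric in the coordinate frame. -/
def gram (A : Matrix (Fin 2) (Fin 2) ℝ) (q : ℝ × ℝ) : Matrix (Fin 2) (Fin 2) ℝ :=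
  Matrix.of fun i j => metric A q (coordVec i) (coordVec j)

/-- The Christoffel symbols `Γᵏᵢⱼ` of the Levi-Civita connection: `D_{∂ᵢ} ∂ⱼ = ∑ₖ Γᵏᵢⱼ ∂ₖ`. -/
def christoffel (A : Matrix (Fin 2) (Fin 2) ℝ) (k i j : Fin 2) (q : ℝ × ℝ) : ℝ :=
  (1 / 2) * ∑ l : Fin 2, (gram A q)⁻¹ k l *
    (partialD i (fun p => gram A p j l) q + partialD j (fun p => gram A p i l) q
      - partialD l (fun p => gram A p i j) q)

/-- The `k`-th component of `D_{∂ᵢ} D_{∂ⱼ} ∂ₘ`. -/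
def secondCov (A : Matrix (Fin 2) (Fin 2) ℝ) (k i j m : Fin 2) (q : ℝ × ℝ) : ℝ :=
  partialD i (christoffel A k j m) q + ∑ l : Fin 2, christoffel A l j m q * christoffel A k i l q

/-- The `k`-th component of `R_{∂₀∂₁} ∂₀`, with the convention
`R_{XY} Z = D_{[X,Y]} Z - [D_X, D_Y] Z`; the coordinate fields commute. -/
def curvatureVec (A : Matrix (Fin 2) (Fin 2) ℝ) (k : Fin 2) (q : ℝ × ℝ) : ℝ :=
  -(secondCov A k 0 1 0 q - secondCov A k 1 0 0 q)

/-- The sectional curvature of the tangent plane at `q`: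
`g(R_{vw} v, w) / (g(v,v) g(w,w) - g(v,w)²)` with `v = ∂₀`, `w = ∂₁`. -/
def sectionalCurvature (A : Matrix (Fin 2) (Fin 2) ℝ) (q : AffPlus) : ℝ :=
  (∑ k : Fin 2, curvatureVec A k q.1 * gram A q.1 k 1) / (gram A q.1).det

/-! ### Causal curves, causal future, Lorentzian distance -/

/-- `q`, restricted to `[0, T]`, is a future directed nonspacelike Lipschitzian curve in
`Aff₊(ℝ)`. Constant curves (`T = 0`) are allowed. -/
structure IsCausalCurve (A : Matrix (Fin 2) (Fin 2) ℝ) (T : ℝ) (q : ℝ → ℝ × ℝ) : Prop where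
  nonneg : 0 ≤ T
  lipschitz : ∃ C, LipschitzOnWith C q (Icc 0 T)
  mem : ∀ t ∈ Icc 0 T, 0 < (q t).2
  nonspacelike : ∀ᵐ t ∂(volume.restrict (Icc 0 T)), metric A (q t) (deriv q t) (deriv q t) ≤ 0
  futureDirected : ∀ᵐ t ∂(volume.restrict (Icc 0 T)),
    metric A (q t) (deriv q t) (timeOrientation A (q t)) < 0

/-- The curve `q` on `[0, T]` is future directed nonspacelike and connects `p` to `r`. -/
def Connects (A : Matrix (Fin 2) (Fin 2) ℝ) (p r : AffPlus) (T : ℝ) (q : ℝ → ℝ × ℝ) : Prop :=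
  IsCausalCurve A T q ∧ q 0 = p.1 ∧ q T = r.1

/-- The Lorentzian length `∫₀ᵀ |g(q̇, q̇)|^(1/2) dt`. -/
def lorentzLength (A : Matrix (Fin 2) (Fin 2) ℝ) (T : ℝ) (q : ℝ → ℝ × ℝ) : ℝ≥0∞ :=
  ∫⁻ t in Icc 0 T, ENNReal.ofReal (√|metric A (q t) (deriv q t) (deriv q t)|)

/-- The causal future `J⁺(p)`. -/
def causalFuture (A : Matrix (Fin 2) (Fin 2) ℝ) (p : AffPlus) : Set AffPlus :=
  {r | ∃ T q, Connects A p r T q}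

/-- The Lorentzian distance: the supremum of the lengths of the future directed nonspacelike
curves from `p` to `r`, and `0` if there are none (`sSup ∅ = 0` in `ℝ≥0∞`). -/
def lorentzDist (A : Matrix (Fin 2) (Fin 2) ℝ) (p r : AffPlus) : ℝ≥0∞ :=
  sSup {L | ∃ T q, Connects A p r T q ∧ L = lorentzLength A T q}

/-! ### The explicit formulas; `A⁻¹ = !![α, β; γ, δ]` and `s₁ = sgn γ` -/

/-- `f = -(α - s₁ β) / (2 γ)`. -/
def coefF (A : Matrix (Fin 2) (Fin 2) ℝ) : ℝ :=
  -((A⁻¹ 0 0 - Real.sign (A⁻¹ 1 0) * A⁻¹ 0 1) / (2 * A⁻¹ 1 0))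

/-- `g = -(α + s₁ β) / (2 γ)`. -/
def coefG (A : Matrix (Fin 2) (Fin 2) ℝ) : ℝ :=
  -((A⁻¹ 0 0 + Real.sign (A⁻¹ 1 0) * A⁻¹ 0 1) / (2 * A⁻¹ 1 0))

/-- `w = (x - g (1 - y)) / f`. -/
def wCoord (A : Matrix (Fin 2) (Fin 2) ℝ) (q : AffPlus) : ℝ :=
  (q.1.1 - coefG A * (1 - q.1.2)) / coefF A

/-- `τ = √(w / (y - y²))`. -/
def tau (A : Matrix (Fin 2) (Fin 2) ℝ) (q : AffPlus) : ℝ :=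
  √(wCoord A q / (q.1.2 - q.1.2 ^ 2))

/-- `ρ = √(w y / (1 - y))`. -/
def rho (A : Matrix (Fin 2) (Fin 2) ℝ) (q : AffPlus) : ℝ :=
  √(wCoord A q * q.1.2 / (1 - q.1.2))

end AffPlus

end

namespace AffPlus

/-! ### Vanishing curvature -/

/-! The curvature equals `(c² - a²) / det²`, so flatness together with `det > 0` and `a ≥ 0` forces
`a > 0` and `c = -s a` with `s = ±1`. The quadratic form is a difference of squares, and for such
`A` one of its two factors depends on `u₂` alone. Both factors then integrate to global null
coordinates `V = s (1 - 1/y)` and `W`, affine in `(x, y)`, with `g = -k² dV dW`, `k = d + s b > 0`.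
Thus `G` is isometric to the half-plane `s V < 1` of the Minkowski plane, with `Id` at the origin
and future cone `dV, dW ≥ 0` (`IsFlat.metric_self`, `IsFlat.causal_iff`).

Along a causal curve `V` and `W` do not decrease, and Cauchy–Schwarz bounds the length by `k √(V W)`
(`IsFlat.length_le`). The half-plane is convex, so when `V, W > 0` the straight segment from the
origin stays in it and attains the bound (`IsFlat.exists_connects`). Hence `int J⁺` is the open
quadrant `V, W > 0`, the distance there is `k √(V W)`, and it vanishes elsewhere.
`IsFlat.explicit_formula` rewrites this value as `(ρ - τ) / γ`. -/

theorem partialD_one_of_hasDerivAt {F : ℝ × ℝ → ℝ} {h : ℝ → ℝ} {h' : ℝ} {q : ℝ × ℝ}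
    (hq : 0 < q.2) (hF : ∀ p : ℝ × ℝ, 0 < p.2 → F p = h p.2) (hh : HasDerivAt h h' q.2) :
    partialD 1 F q = h' := by
  have h1 : HasDerivAt (fun t : ℝ => h (q.2 + t)) h' 0 := by
    have : HasDerivAt h h' (q.2 + 0) := by simpa using hh
    exact HasDerivAt.comp_const_add q.2 0 this
  have h2 : (fun t : ℝ => F (q + t • coordVec 1)) =ᶠ[nhds 0] fun t : ℝ => h (q.2 + t) := by
    have : ∀ᶠ t : ℝ in nhds 0, 0 < q.2 + t :=
      (continuous_const.add continuous_id).continuousAt.eventually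
        (lt_mem_nhds (by simpa using hq))
    filter_upwards [this] with t ht
    have := hF (q + t • coordVec 1) (by simpa [coordVec] using ht)
    simpa [coordVec] using this
  exact (h1.congr_of_eventuallyEq h2).deriv

theorem partialD_zero_of_eq {F : ℝ × ℝ → ℝ} {h : ℝ → ℝ} {q : ℝ × ℝ}
    (hq : 0 < q.2) (hF : ∀ p : ℝ × ℝ, 0 < p.2 → F p = h p.2) :
    partialD 0 F q = 0 := by
  have h2 : (fun t : ℝ => F (q + t • coordVec 0)) = fun _ : ℝ => h q.2 := by
    funext t
    have := hF (q + t • coordVec 0) (by simpa [coordVec] using hq)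
    simpa [coordVec] using this
  simp only [partialD, lineDeriv, h2, deriv_const]

theorem gram_apply (A : Matrix (Fin 2) (Fin 2) ℝ) (q : ℝ × ℝ) (i j : Fin 2) :
    gram A q i j = lieForm A (coordVec i) (coordVec j) / q.2 ^ 2 := by
  simp only [gram, metric, frameCoord, lieForm, Matrix.of_apply]
  ring

theorem partialD_gram (A : Matrix (Fin 2) (Fin 2) ℝ) {q : ℝ × ℝ} (hq : 0 < q.2) (k i j : Fin 2) :
    partialD k (fun p => gram A p i j) q =
      (if k = 1 then -2 * lieForm A (coordVec i) (coordVec j) / q.2 ^ 3 else 0) := by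
  have hF : ∀ p : ℝ × ℝ, 0 < p.2 →
      gram A p i j = (fun y : ℝ => lieForm A (coordVec i) (coordVec j) / y ^ 2) p.2 :=
    fun p _ => gram_apply A p i j
  fin_cases k
  · simpa using partialD_zero_of_eq
      (h := fun y : ℝ => lieForm A (coordVec i) (coordVec j) / y ^ 2) hq hF
  · have : HasDerivAt (fun y : ℝ => lieForm A (coordVec i) (coordVec j) / y ^ 2)
        (-2 * lieForm A (coordVec i) (coordVec j) / q.2 ^ 3) q.2 := by
      have h := (hasDerivAt_const q.2 (lieForm A (coordVec i) (coordVec j))).fun_div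
        (hasDerivAt_pow 2 q.2) (by positivity)
      refine h.congr_deriv ?_
      field_simp
      ring
    simpa using partialD_one_of_hasDerivAt hq hF this

theorem gram_inv (A : Matrix (Fin 2) (Fin 2) ℝ) {q : ℝ × ℝ} (hq : 0 < q.2) :
    (gram A q)⁻¹ = (-(q.2 ^ 2 / A.det ^ 2)) •
      !![lieForm A (0, 1) (0, 1), -lieForm A (1, 0) (0, 1);
        -lieForm A (1, 0) (0, 1), lieForm A (1, 0) (1, 0)] := by
  have hd : (gram A q).det = -(A.det ^ 2 / q.2 ^ 4) := by
    simp only [Matrix.det_fin_two, gram_apply, lieForm, coordVec]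
    simp
    field_simp
    ring
  rw [Matrix.inv_def, hd, Ring.inverse_eq_inv', Matrix.adjugate_fin_two]
  ext i j
  fin_cases i <;> fin_cases j <;>
    simp [gram_apply, coordVec, lieForm] <;> field_simp <;> ring

/-- Homogeneity in `y`: the Gram matrix scales as `y⁻²`, its derivatives as `y⁻³` and its inverse as
`y²`. Derivatives of the symbols at `(0, 1)` thus reduce to their values there, and the curvature at
`Id` becomes algebra in the entries of `A`. -/
theorem christoffel_eq (A : Matrix (Fin 2) (Fin 2) ℝ) (hdet : A.det ≠ 0) {q : ℝ × ℝ}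
    (hq : 0 < q.2) (k i j : Fin 2) :
    christoffel A k i j q = christoffel A k i j (0, 1) / q.2 := by
  simp only [christoffel, gram_inv A hq, gram_inv A (q := (0, 1)) one_pos, partialD_gram A hq,
    partialD_gram A (q := (0, 1)) one_pos, Fin.sum_univ_two, Matrix.smul_apply, smul_eq_mul]
  split_ifs <;> field_simp <;> ring

theorem partialD_christoffel (A : Matrix (Fin 2) (Fin 2) ℝ) (hdet : A.det ≠ 0) (l k i j : Fin 2) :
    partialD l (christoffel A k i j) (0, 1) =
      (if l = 1 then -christoffel A k i j (0, 1) else 0) := by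
  have hF : ∀ p : ℝ × ℝ, 0 < p.2 →
      christoffel A k i j p = (fun y : ℝ => christoffel A k i j (0, 1) / y) p.2 :=
    fun p hp => christoffel_eq A hdet hp k i j
  fin_cases l
  · simpa using partialD_zero_of_eq (q := (0, 1))
      (h := fun y : ℝ => christoffel A k i j (0, 1) / y) one_pos hF
  · have : HasDerivAt (fun y : ℝ => christoffel A k i j (0, 1) / y)
        (-christoffel A k i j (0, 1)) (0, 1).2 := by
      have h := (hasDerivAt_const (1 : ℝ) (christoffel A k i j (0, 1))).fun_div
        (hasDerivAt_id' (1 : ℝ)) one_ne_zero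
      exact h.congr_deriv (by ring)
    simpa using partialD_one_of_hasDerivAt (q := (0, 1)) one_pos hF this

theorem sectionalCurvature_Id (A : Matrix (Fin 2) (Fin 2) ℝ) (hdet : A.det ≠ 0) :
    sectionalCurvature A Id = (A 1 0 ^ 2 - A 0 0 ^ 2) / A.det ^ 2 := by
  have hd : (gram A (0, 1)).det = -(A.det ^ 2) := by
    simp only [Matrix.det_fin_two, gram_apply, lieForm, coordVec]
    simp
    ring
  simp only [sectionalCurvature, Id, hd, curvatureVec, secondCov, partialD_christoffel A hdet,
    Fin.sum_univ_two]
  simp only [christoffel, gram_inv A (q := (0, 1)) one_pos, partialD_gram A (q := (0, 1)) one_pos,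
    Fin.sum_univ_two]
  simp [gram_apply, coordVec, lieForm]
  field_simp
  simp only [Matrix.det_fin_two]
  ring

/-! ### Flat null coordinates -/

/-- The matrices of the flat left-invariant structures, with `s = sgn (A⁻¹ 1 0)`. -/
structure IsFlat (A : Matrix (Fin 2) (Fin 2) ℝ) (s : ℝ) : Prop where
  sign_eq : s = 1 ∨ s = -1
  pos : 0 < A 0 0
  lower_eq : A 1 0 = -s * A 0 0
  scale_pos : 0 < A 1 1 + s * A 0 1

/-- Once `c = -s a`, the determinant factors as `a (d + s b)`, so its positivity excludes `a = 0`
and fixes the sign of the other factor. -/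
theorem exists_isFlat {A : Matrix (Fin 2) (Fin 2) ℝ} (hdet : 0 < A.det) (ha : 0 ≤ A 0 0)
    (hK : sectionalCurvature A Id = 0) : ∃ s, IsFlat A s := by
  rw [sectionalCurvature_Id A hdet.ne', div_eq_zero_iff, sub_eq_zero, sq_eq_sq_iff_eq_or_eq_neg] at hK
  have h2 : A 1 0 = A 0 0 ∨ A 1 0 = -A 0 0 := hK.resolve_right (by positivity)
  have hpos : 0 < A 0 0 := by
    refine lt_of_le_of_ne ha fun h => ?_
    rw [Matrix.det_fin_two] at hdet
    rcases h2 with h2 | h2 <;> rw [h2, ← h] at hdet <;> simp at hdet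
  rw [Matrix.det_fin_two] at hdet
  rcases h2 with h2 | h2
  · refine ⟨-1, Or.inr rfl, hpos, by rw [h2]; ring, ?_⟩
    rw [h2] at hdet
    exact pos_of_mul_pos_right (by linarith : 0 < A 0 0 * (A 1 1 + -1 * A 0 1)) ha
  · refine ⟨1, Or.inl rfl, hpos, by rw [h2]; ring, ?_⟩
    rw [h2] at hdet
    exact pos_of_mul_pos_right (by linarith : 0 < A 0 0 * (A 1 1 + 1 * A 0 1)) ha

/-- The factor relating the flat metric to the null coordinates: `g = -(scale)² dV dW`. -/
noncomputable def scale (A : Matrix (Fin 2) (Fin 2) ℝ) (s : ℝ) : ℝ := A 1 1 + s * A 0 1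

/-- The first null coordinate. -/
noncomputable def nullV (s : ℝ) (q : ℝ × ℝ) : ℝ := s * (1 - q.2⁻¹)

/-- The second null coordinate. -/
noncomputable def nullW (A : Matrix (Fin 2) (Fin 2) ℝ) (s : ℝ) (q : ℝ × ℝ) : ℝ :=
  (2 * A 0 0 * q.1 - (A 0 1 - s * A 1 1) * (1 - q.2)) / scale A s

/-- The differential of `nullV` at `q`. -/
noncomputable def dNullV (s : ℝ) (q ξ : ℝ × ℝ) : ℝ := s * ξ.2 / q.2 ^ 2

/-- The differential of `nullW`. -/
noncomputable def dNullW (A : Matrix (Fin 2) (Fin 2) ℝ) (s : ℝ) (ξ : ℝ × ℝ) : ℝ :=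
  (2 * A 0 0 * ξ.1 + (A 0 1 - s * A 1 1) * ξ.2) / scale A s

@[simp] theorem nullV_Id (s : ℝ) : nullV s Id.1 = 0 := by simp [nullV, Id]

@[simp] theorem nullW_Id (A : Matrix (Fin 2) (Fin 2) ℝ) (s : ℝ) : nullW A s Id.1 = 0 := by
  simp [nullW, Id]

theorem hasDerivAt_nullV (s : ℝ) {q : ℝ → ℝ × ℝ} {ξ : ℝ × ℝ} {t : ℝ} (hq : HasDerivAt q ξ t)
    (hy : (q t).2 ≠ 0) : HasDerivAt (fun t => nullV s (q t)) (dNullV s (q t) ξ) t := by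
  have h2 : HasDerivAt (fun t => (q t).2) ξ.2 t := hq.snd
  refine (((h2.fun_inv hy).const_sub 1).const_mul s).congr_deriv ?_
  simp only [dNullV]
  ring

theorem hasDerivAt_nullW (A : Matrix (Fin 2) (Fin 2) ℝ) (s : ℝ) {q : ℝ → ℝ × ℝ} {ξ : ℝ × ℝ}
    {t : ℝ} (hq : HasDerivAt q ξ t) :
    HasDerivAt (fun t => nullW A s (q t)) (dNullW A s ξ) t := by
  have h1 : HasDerivAt (fun t => (q t).1) ξ.1 t := hq.fst
  have h2 : HasDerivAt (fun t => (q t).2) ξ.2 t := hq.snd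
  refine (((h1.const_mul (2 * A 0 0)).fun_sub
    ((h2.const_sub 1).const_mul (A 0 1 - s * A 1 1))).div_const (scale A s)).congr_deriv ?_
  simp only [dNullW]
  ring

theorem contDiffOn_nullV (s : ℝ) : ContDiffOn ℝ 1 (nullV s) {q | 0 < q.2} := by
  have h : ContDiffOn ℝ 1 (fun q : ℝ × ℝ => q.2⁻¹) {q | 0 < q.2} :=
    contDiff_snd.contDiffOn.inv fun q hq => ne_of_gt hq
  exact contDiffOn_const.mul (contDiffOn_const.sub h)

theorem contDiff_nullW (A : Matrix (Fin 2) (Fin 2) ℝ) (s : ℝ) : ContDiff ℝ 1 (nullW A s) := by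
  unfold nullW
  fun_prop

namespace IsFlat

variable {A : Matrix (Fin 2) (Fin 2) ℝ} {s : ℝ}

theorem mul_self (h : IsFlat A s) : s * s = 1 := by
  rcases h.sign_eq with rfl | rfl <;> norm_num

theorem scale_pos' (h : IsFlat A s) : 0 < scale A s := h.scale_pos

theorem det_eq (h : IsFlat A s) : A.det = A 0 0 * scale A s := by
  rw [Matrix.det_fin_two, h.lower_eq, scale]
  ring

theorem det_pos (h : IsFlat A s) : 0 < A.det := h.det_eq ▸ mul_pos h.pos h.scale_pos'

theorem metric_self (h : IsFlat A s) (q ξ : ℝ × ℝ) :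
    metric A q ξ ξ = -(scale A s ^ 2 * (dNullV s q ξ * dNullW A s ξ)) := by
  have hk := h.scale_pos'.ne'
  simp only [metric, lieForm, frameCoord, dNullV, dNullW, h.lower_eq]
  have e : scale A s ^ 2 * (s * ξ.2 / q.2 ^ 2 *
      ((2 * A 0 0 * ξ.1 + (A 0 1 - s * A 1 1) * ξ.2) / scale A s)) =
      scale A s * (s * ξ.2 / q.2 ^ 2 * (2 * A 0 0 * ξ.1 + (A 0 1 - s * A 1 1) * ξ.2)) := by
    field_simp
  rw [e, scale]
  rcases h.sign_eq with rfl | rfl <;> ring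

/-- Since `A` sends the components of `Y₁` to `(1, 0)`, the pairing is `-(a u₁ + b u₂)`, which is a
negative combination of the two null differentials. -/
theorem metric_timeOrientation (h : IsFlat A s) {q : ℝ × ℝ} (hq : 0 < q.2) (ξ : ℝ × ℝ) :
    metric A q ξ (timeOrientation A q) =
      -(scale A s / (2 * q.2) * (dNullW A s ξ + q.2 ^ 2 * dNullV s q ξ)) := by
  have hk := h.scale_pos'.ne'
  have hu : IsUnit A.det := h.det_pos.ne'.isUnit
  have h1 := congrFun (congrFun (A.mul_nonsing_inv hu) 0) 0
  have h2 := congrFun (congrFun (A.mul_nonsing_inv hu) 1) 0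
  simp only [Matrix.mul_apply, Fin.sum_univ_two, Matrix.one_apply_eq] at h1 h2
  have e1 : metric A q ξ (timeOrientation A q) = -((A 0 0 * ξ.1 + A 0 1 * ξ.2) / q.2) := by
    simp only [metric, lieForm, frameCoord, timeOrientation, leftInvField]
    rw [mul_div_cancel_left₀ _ hq.ne', mul_div_cancel_left₀ _ hq.ne', h1, h2]
    simp
    ring
  rw [e1, dNullW, dNullV]
  field_simp
  rw [scale]
  rcases h.sign_eq with rfl | rfl <;> ring

theorem causal_iff (h : IsFlat A s) {q : ℝ × ℝ} (hq : 0 < q.2) (ξ : ℝ × ℝ) :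
    (metric A q ξ ξ ≤ 0 ∧ metric A q ξ (timeOrientation A q) < 0) ↔
      0 ≤ dNullV s q ξ ∧ 0 ≤ dNullW A s ξ ∧ 0 < dNullV s q ξ + dNullW A s ξ := by
  have hk := h.scale_pos'
  rw [h.metric_self, h.metric_timeOrientation hq, neg_nonpos, neg_lt_zero,
    mul_nonneg_iff_of_pos_left (by positivity), mul_pos_iff_of_pos_left (by positivity)]
  have hy : 0 < q.2 ^ 2 := by positivity
  constructor
  · rintro ⟨h1, h2⟩
    -- A nonnegative product leaves two opposite cones; the time orientation rules out the past one.
    rcases mul_nonneg_iff.1 h1 with ⟨hv, hw⟩ | ⟨hv, hw⟩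
    · refine ⟨hv, hw, ?_⟩
      by_contra! hlt
      have hv0 : dNullV s q ξ = 0 := by linarith
      have hw0 : dNullW A s ξ = 0 := by linarith
      simp [hv0, hw0] at h2
    · nlinarith
  · rintro ⟨hv, hw, hvw⟩
    refine ⟨mul_nonneg hv hw, ?_⟩
    rcases hv.eq_or_lt with hv0 | hv0
    · rw [← hv0] at hvw ⊢
      simpa using hvw
    · positivity

theorem inv_eq (h : IsFlat A s) :
    A⁻¹ 0 0 = A 1 1 / A.det ∧ A⁻¹ 0 1 = -A 0 1 / A.det ∧ A⁻¹ 1 0 = s / scale A s := by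
  have hk := h.scale_pos'.ne'
  have ha := h.pos.ne'
  rw [Matrix.inv_def, Ring.inverse_eq_inv', Matrix.adjugate_fin_two]
  refine ⟨?_, ?_, ?_⟩
  · simp; ring
  · simp; ring
  · simp [h.lower_eq, h.det_eq]; field_simp

theorem sign_inv (h : IsFlat A s) : Real.sign (A⁻¹ 1 0) = s := by
  rw [h.inv_eq.2.2]
  have hk := h.scale_pos'
  rcases h.sign_eq with rfl | rfl
  · exact Real.sign_of_pos (by positivity)
  · exact Real.sign_of_neg (div_neg_of_neg_of_pos (by norm_num) hk)

theorem inv_ne_zero (h : IsFlat A s) : A⁻¹ 1 0 ≠ 0 := by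
  rw [h.inv_eq.2.2]
  have hs : s ≠ 0 := by rcases h.sign_eq with rfl | rfl <;> norm_num
  exact div_ne_zero hs h.scale_pos'.ne'

theorem coefF_eq (h : IsFlat A s) : coefF A = -(s * scale A s / (2 * A 0 0)) := by
  have hk := h.scale_pos'.ne'
  have ha := h.pos.ne'
  rw [coefF, h.sign_inv, h.inv_eq.1, h.inv_eq.2.1, h.inv_eq.2.2, h.det_eq]
  rcases h.sign_eq with rfl | rfl <;> field_simp <;> simp only [scale] <;> ring

theorem coefG_eq (h : IsFlat A s) : coefG A = (A 0 1 - s * A 1 1) / (2 * A 0 0) := by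
  have hk := h.scale_pos'.ne'
  have ha := h.pos.ne'
  rw [coefG, h.sign_inv, h.inv_eq.1, h.inv_eq.2.1, h.inv_eq.2.2, h.det_eq]
  rcases h.sign_eq with rfl | rfl <;> field_simp <;> ring

theorem coefF_ne_zero (h : IsFlat A s) : coefF A ≠ 0 := by
  have hk := h.scale_pos'.ne'
  have ha := h.pos.ne'
  have hs : s ≠ 0 := by rcases h.sign_eq with rfl | rfl <;> norm_num
  rw [h.coefF_eq, neg_ne_zero]
  positivity

theorem wCoord_eq (h : IsFlat A s) (q : AffPlus) : wCoord A q = -s * nullW A s q.1 := by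
  have hk := h.scale_pos'.ne'
  have ha := h.pos.ne'
  rw [wCoord, h.coefF_eq, h.coefG_eq, nullW]
  rcases h.sign_eq with rfl | rfl <;> field_simp

/-- The explicit distance formula in null coordinates. -/
theorem explicit_formula (h : IsFlat A s) (q : AffPlus) (hV : 0 < nullV s q.1)
    (hW : 0 < nullW A s q.1) :
    q.1.2 ≠ 1 ∧ 0 < wCoord A q / (q.1.2 - q.1.2 ^ 2) ∧ 0 < wCoord A q * q.1.2 / (1 - q.1.2) ∧
      (rho A q - tau A q) / A⁻¹ 1 0 = scale A s * √(nullV s q.1 * nullW A s q.1) := by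
  have hk := h.scale_pos'
  have hy := q.2
  set y := q.1.2 with hy_def
  set W := nullW A s q.1 with hW_def
  have hV' : nullV s q.1 = s * (y - 1) / y := by
    rw [nullV, ← hy_def]; field_simp
  have hsy : 0 < s * (y - 1) := by
    rw [hV', lt_div_iff₀ hy] at hV
    simpa using hV
  have hy1 : y - 1 ≠ 0 := fun h0 => by simp [h0] at hsy
  have hy1' : 1 - y ≠ 0 := fun h0 => hy1 (by linarith)
  have hs0 : s ≠ 0 := by rcases h.sign_eq with rfl | rfl <;> norm_num
  -- With `m = s (y - 1) > 0`, this and the next identity give `τ = √(V W) / m` and `ρ = y √(V W) /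
  -- m`, so `ρ - τ = s √(V W)`, while `γ = s / k`.
  have e1 : wCoord A q / (y - y ^ 2) = (1 / (s * (y - 1))) ^ 2 * (nullV s q.1 * W) := by
    rw [h.wCoord_eq, hV', ← hW_def]
    rcases h.sign_eq with rfl | rfl <;> field_simp <;> ring
  have e2 : wCoord A q * y / (1 - y) = (y / (s * (y - 1))) ^ 2 * (nullV s q.1 * W) := by
    rw [h.wCoord_eq, hV', ← hW_def]
    rcases h.sign_eq with rfl | rfl <;> field_simp <;> ring
  refine ⟨fun h0 => hy1 (by linarith), by rw [e1]; positivity, by rw [e2]; positivity, ?_⟩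
  rw [rho, tau, ← hy_def, e1, e2, Real.sqrt_mul (sq_nonneg _), Real.sqrt_mul (sq_nonneg _),
    Real.sqrt_sq (by positivity), Real.sqrt_sq (by positivity), h.inv_eq.2.2]
  rcases h.sign_eq with rfl | rfl <;> field_simp
  ring

end IsFlat

/-! ### The upper bound for the length of causal curves -/

theorem ae_differentiableAt_of_lipschitzOnWith_Icc {E : Type*} [NormedAddCommGroup E]
    [NormedSpace ℝ E] [FiniteDimensional ℝ E] {a b : ℝ} {C : NNReal} {q : ℝ → E}
    (hq : LipschitzOnWith C q (Icc a b)) :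
    ∀ᵐ t ∂(volume.restrict (Icc a b)), DifferentiableAt ℝ q t := by
  rw [← Measure.restrict_congr_set (Ioo_ae_eq_Icc (μ := volume)), ae_restrict_iff' measurableSet_Ioo]
  filter_upwards [hq.ae_differentiableWithinAt_of_mem (μ := volume)] with t ht hmem
  exact (ht (Ioo_subset_Icc_self hmem)).differentiableAt (Icc_mem_nhds hmem.1 hmem.2)

/-- The image of the curve is compact in the open half-plane, so a locally Lipschitz function is
Lipschitz on it, even though `1/y` is not on the whole half-plane. -/
theorem exists_lipschitzOnWith_comp {F : ℝ × ℝ → ℝ} (hF : ContDiffOn ℝ 1 F {q | 0 < q.2})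
    {a b : ℝ} {C : NNReal} {q : ℝ → ℝ × ℝ} (hq : LipschitzOnWith C q (Icc a b))
    (hpos : ∀ t ∈ Icc a b, 0 < (q t).2) :
    ∃ K, LipschitzOnWith K (fun t => F (q t)) (Icc a b) := by
  have hopen : IsOpen {q : ℝ × ℝ | 0 < q.2} := isOpen_lt continuous_const continuous_snd
  have hloc : LocallyLipschitzOn (q '' Icc a b) F := by
    rintro _ ⟨t, ht, rfl⟩
    obtain ⟨K, u, hu, hK⟩ :=
      (hF.contDiffAt (hopen.mem_nhds (hpos t ht))).exists_lipschitzOnWith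
    exact ⟨K, u, mem_nhdsWithin_of_mem_nhds hu, hK⟩
  obtain ⟨K, hK⟩ := hloc.exists_lipschitzOnWith_of_compact
    (isCompact_Icc.image_of_continuousOn hq.continuousOn)
  exact ⟨K * C, hK.comp hq (mapsTo_image q _)⟩

theorem lintegral_deriv_of_lipschitzOnWith {f : ℝ → ℝ} {a b : ℝ} (hab : a ≤ b) {C : NNReal}
    (hf : LipschitzOnWith C f (Icc a b))
    (hpos : ∀ᵐ t ∂(volume.restrict (Icc a b)), 0 ≤ deriv f t) :
    ∫⁻ t in Icc a b, ENNReal.ofReal (deriv f t) = ENNReal.ofReal (f b - f a) ∧ f a ≤ f b := by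
  have hac : AbsolutelyContinuousOnInterval f a b :=
    LipschitzOnWith.absolutelyContinuousOnInterval (K := C) (by rwa [uIcc_of_le hab])
  have hint : IntegrableOn (deriv f) (Icc a b) := by
    rw [integrableOn_Icc_iff_integrableOn_Ioc, ← intervalIntegrable_iff_integrableOn_Ioc_of_le hab]
    exact hac.intervalIntegrable_deriv
  have heq : ∫ t in Icc a b, deriv f t = f b - f a := by
    rw [integral_Icc_eq_integral_Ioc, ← intervalIntegral.integral_of_le hab]
    exact hac.integral_deriv_eq_sub
  refine ⟨by rw [← ofReal_integral_eq_lintegral_ofReal hint hpos, heq], ?_⟩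
  rw [← sub_nonneg, ← heq]
  exact integral_nonneg_of_ae hpos

theorem lintegral_sqrt_mul_le {μ : Measure ℝ} {f g : ℝ → ℝ} (hf : Measurable f)
    (hg : Measurable g) (hf0 : ∀ᵐ t ∂μ, 0 ≤ f t) :
    ∫⁻ t, ENNReal.ofReal (√(f t * g t)) ∂μ ≤
      (∫⁻ t, ENNReal.ofReal (f t) ∂μ) ^ (1 / 2 : ℝ) *
        (∫⁻ t, ENNReal.ofReal (g t) ∂μ) ^ (1 / 2 : ℝ) := by
  -- For negative `x` both sides are `0` by the conventions for `√` and `ENNReal.ofReal`.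
  have hsq : ∀ x : ℝ, ENNReal.ofReal (√x) ^ (2 : ℝ) = ENNReal.ofReal x := fun x => by
    rw [ENNReal.ofReal_rpow_of_nonneg (Real.sqrt_nonneg x) (by norm_num)]
    rcases le_total 0 x with hx | hx
    · rw [Real.rpow_two, Real.sq_sqrt hx]
    · simp [Real.sqrt_eq_zero_of_nonpos hx, ENNReal.ofReal_of_nonpos hx]
  have h := ENNReal.lintegral_mul_le_Lp_mul_Lq μ Real.HolderConjugate.two_two
    (f := fun t => ENNReal.ofReal (√(f t))) (g := fun t => ENNReal.ofReal (√(g t)))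
    (by fun_prop) (by fun_prop)
  simp only [hsq] at h
  refine le_trans (le_of_eq (lintegral_congr_ae ?_)) h
  filter_upwards [hf0] with t ht
  simp only [Pi.mul_apply]
  rw [Real.sqrt_mul ht, ENNReal.ofReal_mul (Real.sqrt_nonneg _)]

namespace IsFlat

variable {A : Matrix (Fin 2) (Fin 2) ℝ} {s : ℝ}

theorem length_le (h : IsFlat A s) {T : ℝ} {q : ℝ → ℝ × ℝ} {r : AffPlus}
    (hq : Connects A Id r T q) :
    0 ≤ nullV s r.1 ∧ 0 ≤ nullW A s r.1 ∧
      lorentzLength A T q ≤ ENNReal.ofReal (scale A s * √(nullV s r.1 * nullW A s r.1)) := by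
  obtain ⟨hc, h0, hT⟩ := hq
  obtain ⟨C, hC⟩ := hc.lipschitz
  obtain ⟨K, hK⟩ := exists_lipschitzOnWith_comp (contDiffOn_nullV s) hC hc.mem
  obtain ⟨L, hL⟩ := exists_lipschitzOnWith_comp (contDiff_nullW A s).contDiffOn hC hc.mem
  set v := fun t => nullV s (q t) with hv
  set w := fun t => nullW A s (q t) with hw
  have key : ∀ᵐ t ∂(volume.restrict (Icc 0 T)), 0 ≤ deriv v t ∧ 0 ≤ deriv w t ∧
      metric A (q t) (deriv q t) (deriv q t) = -(scale A s ^ 2 * (deriv v t * deriv w t)) := by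
    filter_upwards [hc.nonspacelike, hc.futureDirected,
      ae_differentiableAt_of_lipschitzOnWith_Icc hC, ae_restrict_mem measurableSet_Icc]
      with t h1 h2 h3 h4
    have hy := hc.mem t h4
    rw [(hasDerivAt_nullV s h3.hasDerivAt hy.ne').deriv, (hasDerivAt_nullW A s h3.hasDerivAt).deriv]
    have := (h.causal_iff hy _).1 ⟨h1, h2⟩
    exact ⟨this.1, this.2.1, h.metric_self _ _⟩
  obtain ⟨iv, mv⟩ := lintegral_deriv_of_lipschitzOnWith hc.nonneg hK (key.mono fun t ht => ht.1)
  obtain ⟨iw, mw⟩ := lintegral_deriv_of_lipschitzOnWith hc.nonneg hL (key.mono fun t ht => ht.2.1)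
  have v0 : v 0 = 0 := by simp [hv, h0]
  have w0 : w 0 = 0 := by simp [hw, h0]
  have vT : v T = nullV s r.1 := by simp [hv, hT]
  have wT : w T = nullW A s r.1 := by simp [hw, hT]
  rw [v0, vT] at mv
  rw [w0, wT] at mw
  rw [v0, vT, sub_zero] at iv
  rw [w0, wT, sub_zero] at iw
  refine ⟨mv, mw, ?_⟩
  have hk := h.scale_pos'
  calc lorentzLength A T q
      = ∫⁻ t in Icc 0 T, ENNReal.ofReal (scale A s) *
          ENNReal.ofReal (√(deriv v t * deriv w t)) := by
        refine lintegral_congr_ae ?_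
        filter_upwards [key] with t ht
        rw [ht.2.2, abs_neg, abs_of_nonneg (mul_nonneg (sq_nonneg _) (mul_nonneg ht.1 ht.2.1)),
          Real.sqrt_mul (sq_nonneg _), Real.sqrt_sq hk.le, ENNReal.ofReal_mul hk.le]
    _ = ENNReal.ofReal (scale A s) *
          ∫⁻ t in Icc 0 T, ENNReal.ofReal (√(deriv v t * deriv w t)) :=
        lintegral_const_mul' _ _ ENNReal.ofReal_ne_top
    _ ≤ ENNReal.ofReal (scale A s) * (ENNReal.ofReal (nullV s r.1) ^ (1 / 2 : ℝ) *
          ENNReal.ofReal (nullW A s r.1) ^ (1 / 2 : ℝ)) := by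
        rw [← iv, ← iw]
        gcongr
        exact lintegral_sqrt_mul_le (measurable_deriv v) (measurable_deriv w)
          (key.mono fun t ht => ht.1)
    _ = ENNReal.ofReal (scale A s * √(nullV s r.1 * nullW A s r.1)) := by
        rw [ENNReal.ofReal_rpow_of_nonneg mv (by norm_num),
          ENNReal.ofReal_rpow_of_nonneg mw (by norm_num), ← Real.sqrt_eq_rpow, ← Real.sqrt_eq_rpow,
          ← ENNReal.ofReal_mul (Real.sqrt_nonneg _), ← ENNReal.ofReal_mul hk.le,
          Real.sqrt_mul mv]

/-! ### Straight lines in the null coordinates -/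

/-- The point with null coordinates `(v, w)`. -/
noncomputable def ofNull (A : Matrix (Fin 2) (Fin 2) ℝ) (s v w : ℝ) : ℝ × ℝ :=
  ((scale A s * w + (A 0 1 - s * A 1 1) * (1 - (1 - s * v)⁻¹)) / (2 * A 0 0), (1 - s * v)⁻¹)

theorem nullV_ofNull (h : IsFlat A s) (v w : ℝ) : nullV s (ofNull A s v w) = v := by
  simp only [nullV, ofNull, inv_inv]
  linear_combination v * h.mul_self

theorem nullW_ofNull (h : IsFlat A s) (v w : ℝ) : nullW A s (ofNull A s v w) = w := by
  have ha := h.pos.ne'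
  have hk := h.scale_pos'.ne'
  simp only [nullW, ofNull]
  field_simp
  ring

/-- Identifies the range of the null chart: `y > 0` becomes the half-plane `s V < 1`. -/
theorem one_sub_mul_nullV (h : IsFlat A s) (q : ℝ × ℝ) : 1 - s * nullV s q = q.2⁻¹ := by
  simp only [nullV]
  linear_combination (q.2⁻¹ - 1) * h.mul_self

theorem ofNull_null (h : IsFlat A s) (q : ℝ × ℝ) :
    ofNull A s (nullV s q) (nullW A s q) = q := by
  have ha := h.pos.ne'
  have hk := h.scale_pos'.ne'
  refine Prod.ext ?_ ?_
  · simp only [ofNull, h.one_sub_mul_nullV, inv_inv, nullW]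
    field_simp
    ring
  · simp only [ofNull, h.one_sub_mul_nullV, inv_inv]

theorem exists_connects (h : IsFlat A s) (r : AffPlus) (hV : 0 < nullV s r.1)
    (hW : 0 < nullW A s r.1) :
    ∃ T q, Connects A Id r T q ∧
      lorentzLength A T q = ENNReal.ofReal (scale A s * √(nullV s r.1 * nullW A s r.1)) := by
  set V := nullV s r.1 with hVd
  set W := nullW A s r.1 with hWd
  have hk := h.scale_pos'
  let q : ℝ → ℝ × ℝ := fun t => ofNull A s (t * V) (t * W)
  have hden : ∀ t ∈ Icc (0 : ℝ) 1, 0 < 1 - s * (t * V) := by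
    intro t ht
    have h1 : 0 < 1 - s * V := by rw [hVd, h.one_sub_mul_nullV]; exact inv_pos.2 r.2
    -- Convexity of the half-plane: a convex combination of the positive values at the two
    -- endpoints.
    have h2 : 1 - s * (t * V) = (1 - t) + t * (1 - s * V) := by ring
    rw [h2]
    rcases ht.1.eq_or_lt with h0 | h0
    · rw [← h0]; norm_num
    · have := ht.2
      have := mul_pos h0 h1
      linarith
  have hinv : ContDiffOn ℝ 1 (fun t : ℝ => (1 - s * (t * V))⁻¹) (Icc 0 1) :=
    ContDiffOn.inv (by fun_prop) fun t ht => (hden t ht).ne'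
  have hsmooth : ContDiffOn ℝ 1 q (Icc 0 1) := by
    refine ContDiffOn.prodMk ?_ hinv
    refine ContDiffOn.div_const ?_ _
    exact ContDiffOn.add (by fun_prop) (contDiffOn_const.mul (contDiffOn_const.sub hinv))
  have hmem : ∀ t ∈ Icc (0 : ℝ) 1, 0 < (q t).2 := fun t ht => inv_pos.2 (hden t ht)
  have hder : ∀ t ∈ Icc (0 : ℝ) 1, dNullV s (q t) (deriv q t) = V ∧ dNullW A s (deriv q t) = W := by
    intro t ht
    have hne := (hden t ht).ne'
    have hdiff : DifferentiableAt ℝ q t := by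
      have hi : DifferentiableAt ℝ (fun t : ℝ => (1 - s * (t * V))⁻¹) t :=
        DifferentiableAt.fun_inv (by fun_prop) hne
      refine DifferentiableAt.prodMk ?_ hi
      refine DifferentiableAt.div_const ?_ _
      exact DifferentiableAt.add (by fun_prop) ((hi.const_sub 1).const_mul _)
    have e1 := hasDerivAt_nullV s hdiff.hasDerivAt (hmem t ht).ne'
    have e2 := hasDerivAt_nullW A s hdiff.hasDerivAt
    -- In null coordinates the curve is `t ↦ (t V, t W)`; uniqueness of derivatives gives its
    -- constant velocity.
    simp only [q, h.nullV_ofNull, h.nullW_ofNull] at e1 e2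
    exact ⟨e1.unique (hasDerivAt_mul_const V), e2.unique (hasDerivAt_mul_const W)⟩
  have hcausal : ∀ t ∈ Icc (0 : ℝ) 1, metric A (q t) (deriv q t) (deriv q t) ≤ 0 ∧
      metric A (q t) (deriv q t) (timeOrientation A (q t)) < 0 := by
    intro t ht
    rw [h.causal_iff (hmem t ht), (hder t ht).1, (hder t ht).2]
    exact ⟨hV.le, hW.le, by positivity⟩
  refine ⟨1, q, ⟨⟨zero_le_one, ?_, hmem, ?_, ?_⟩, ?_, ?_⟩, ?_⟩
  · exact hsmooth.exists_lipschitzOnWith one_ne_zero (convex_Icc _ _) isCompact_Icc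
  · filter_upwards [ae_restrict_mem measurableSet_Icc] with t ht using (hcausal t ht).1
  · filter_upwards [ae_restrict_mem measurableSet_Icc] with t ht using (hcausal t ht).2
  · simp [q, ofNull, Id]
  · simp only [q, one_mul]
    exact h.ofNull_null r.1
  · have : ∀ t ∈ Icc (0 : ℝ) 1,
        ENNReal.ofReal (√|metric A (q t) (deriv q t) (deriv q t)|) =
          ENNReal.ofReal (scale A s * √(V * W)) := by
      intro t ht
      rw [h.metric_self, (hder t ht).1, (hder t ht).2, abs_neg, abs_of_nonneg (by positivity),
        Real.sqrt_mul (sq_nonneg _), Real.sqrt_sq hk.le]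
    rw [lorentzLength, setLIntegral_congr_fun measurableSet_Icc this]
    simp

/-! ### The distance, the causal future and its interior -/

theorem lorentzDist_eq (h : IsFlat A s) (r : AffPlus) (hV : 0 < nullV s r.1)
    (hW : 0 < nullW A s r.1) :
    lorentzDist A Id r = ENNReal.ofReal (scale A s * √(nullV s r.1 * nullW A s r.1)) := by
  refine le_antisymm (sSup_le ?_) ?_
  · rintro L ⟨T, q, hq, rfl⟩
    exact (h.length_le hq).2.2
  · obtain ⟨T, q, hq, hL⟩ := h.exists_connects r hV hW
    exact le_sSup ⟨T, q, hq, hL.symm⟩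

theorem continuous_nullV (s : ℝ) : Continuous fun q : AffPlus => nullV s q.1 := by
  have : Continuous fun q : AffPlus => q.1.2⁻¹ :=
    (continuous_snd.comp continuous_subtype_val).inv₀ fun q => q.2.ne'
  exact continuous_const.mul (continuous_const.sub this)

theorem continuous_nullW (A : Matrix (Fin 2) (Fin 2) ℝ) (s : ℝ) :
    Continuous fun q : AffPlus => nullW A s q.1 :=
  (contDiff_nullW A s).continuous.comp continuous_subtype_val

theorem interior_causalFuture (h : IsFlat A s) :
    interior (causalFuture A Id) = {q | 0 < nullV s q.1 ∧ 0 < nullW A s q.1} := by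
  refine Subset.antisymm ?_ (interior_maximal ?_ ?_)
  · intro q hq
    let V := nullV s q.1
    let W := nullW A s q.1
    have hden : 0 < 1 - s * V := by rw [h.one_sub_mul_nullV]; exact inv_pos.2 q.2
    -- An interior point can be moved slightly along `(-1, -1)` in null coordinates and remain in
    -- `J⁺`, whose points satisfy `V, W ≥ 0`; hence its own coordinates are strictly positive.
    have hnear : ∀ᶠ t in nhds (0 : ℝ), 0 < 1 - s * (V - t) := by
      have hc : Continuous fun t : ℝ => 1 - s * (V - t) := by fun_prop
      exact hc.continuousAt.eventually (lt_mem_nhds (by simpa using hden))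
    have hcont : ContinuousAt (fun t : ℝ => ofNull A s (V - t) (W - t)) 0 := by
      have hi : ContinuousAt (fun t : ℝ => (1 - s * (V - t))⁻¹) 0 :=
        ContinuousAt.inv₀ (by fun_prop) (by simpa using hden.ne')
      refine ContinuousAt.prodMk ?_ hi
      refine ContinuousAt.div_const ?_ _
      exact ContinuousAt.add (by fun_prop) (continuousAt_const.mul (continuousAt_const.sub hi))
    obtain ⟨U, hU, hUq⟩ := mem_nhds_subtype _ _ _ |>.1 (mem_interior_iff_mem_nhds.1 hq)
    have hlim : ∀ᶠ t in nhds (0 : ℝ), ofNull A s (V - t) (W - t) ∈ U :=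
      hcont.eventually (by simpa [V, W, h.ofNull_null] using hU)
    obtain ⟨t, ⟨ht1, ht2⟩, ht3⟩ :=
      (((hnear.and hlim).filter_mono nhdsWithin_le_nhds).and
        (self_mem_nhdsWithin : Ioi (0 : ℝ) ∈ nhdsWithin 0 (Ioi 0))).exists
    obtain ⟨T, c, hc⟩ := hUq (a := ⟨ofNull A s (V - t) (W - t), inv_pos.2 ht1⟩) ht2
    obtain ⟨hv, hw, -⟩ := h.length_le hc
    rw [h.nullV_ofNull] at hv
    rw [h.nullW_ofNull] at hw
    have ht : 0 < t := ht3
    exact ⟨by linarith, by linarith⟩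
  · rintro q ⟨hV, hW⟩
    obtain ⟨T, c, hc, -⟩ := h.exists_connects q hV hW
    exact ⟨T, c, hc⟩
  · exact (isOpen_lt continuous_const (continuous_nullV s)).inter
      (isOpen_lt continuous_const (continuous_nullW A s))

end IsFlat

theorem lorentzDist_eq_zero_of_notMem {A : Matrix (Fin 2) (Fin 2) ℝ} {p r : AffPlus}
    (hr : r ∉ causalFuture A p) : lorentzDist A p r = 0 := by
  refine le_antisymm (sSup_le ?_) zero_le
  rintro L ⟨T, q, hq, -⟩
  exact absurd ⟨T, q, hq⟩ hr

/-- A point of `J⁺` outside the interior has `V W = 0`, so the length bound is zero. This covers the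
frontier. -/
theorem IsFlat.lorentzDist_eq_zero_of_notMem_interior {A : Matrix (Fin 2) (Fin 2) ℝ} {s : ℝ}
    (h : IsFlat A s) {r : AffPlus} (hr : r ∉ interior (causalFuture A Id)) :
    lorentzDist A Id r = 0 := by
  refine le_antisymm (sSup_le ?_) zero_le
  rintro L ⟨T, q, hq, rfl⟩
  obtain ⟨hV, hW, hL⟩ := h.length_le hq
  have : nullV s r.1 * nullW A s r.1 = 0 := by
    by_contra hne
    rw [mul_eq_zero, not_or] at hne
    rw [h.interior_causalFuture] at hr
    exact hr ⟨hV.lt_of_ne' hne.1, hW.lt_of_ne' hne.2⟩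
  simpa [this] using hL

end AffPlus

/-- The Lorentzian distance from the identity for a left-invariant Lorentzian structure of
constant curvature zero on `Aff₊(ℝ)`. The third part also records that the explicit formulas are
meaningful: no denominator vanishes and both radicands are positive. -/
theorem mainTheorem5 (A : Matrix (Fin 2) (Fin 2) ℝ) (hdet : 0 < A.det) (ha : 0 ≤ A 0 0)
    (hK : ∀ q : AffPlus, AffPlus.sectionalCurvature A q = 0) :
    (∀ q : AffPlus, q ∉ AffPlus.causalFuture A AffPlus.Id →
      AffPlus.lorentzDist A AffPlus.Id q = 0) ∧
    (∀ q : AffPlus, q ∈ frontier (AffPlus.causalFuture A AffPlus.Id) →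
      AffPlus.lorentzDist A AffPlus.Id q = 0) ∧
    (A⁻¹ 1 0 ≠ 0 ∧ AffPlus.coefF A ≠ 0 ∧
      ∀ q : AffPlus, q ∈ interior (AffPlus.causalFuture A AffPlus.Id) →
        q.1.2 ≠ 1 ∧
        0 < AffPlus.wCoord A q / (q.1.2 - q.1.2 ^ 2) ∧
        0 < AffPlus.wCoord A q * q.1.2 / (1 - q.1.2) ∧
        0 < (AffPlus.rho A q - AffPlus.tau A q) / A⁻¹ 1 0 ∧
        AffPlus.lorentzDist A AffPlus.Id q =
          ENNReal.ofReal ((AffPlus.rho A q - AffPlus.tau A q) / A⁻¹ 1 0)) ∧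
    AffPlus.lorentzDist A AffPlus.Id '' interior (AffPlus.causalFuture A AffPlus.Id) =
      Set.Ioo 0 ⊤ := by
  obtain ⟨s, h⟩ := AffPlus.exists_isFlat hdet ha (hK AffPlus.Id)
  have hk := h.scale_pos'
  refine ⟨fun q hq => AffPlus.lorentzDist_eq_zero_of_notMem hq,
    fun q hq => h.lorentzDist_eq_zero_of_notMem_interior hq.2,
    ⟨h.inv_ne_zero, h.coefF_ne_zero, ?_⟩, ?_⟩
  · intro q hq
    rw [h.interior_causalFuture] at hq
    obtain ⟨hV, hW⟩ := hq
    obtain ⟨h1, h2, h3, h4⟩ := h.explicit_formula q hV hW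
    refine ⟨h1, h2, h3, ?_, ?_⟩
    · rw [h4]; positivity
    · rw [h4, h.lorentzDist_eq q hV hW]
  · rw [h.interior_causalFuture]
    ext L
    constructor
    · rintro ⟨q, ⟨hV, hW⟩, rfl⟩
      rw [h.lorentzDist_eq q hV hW]
      exact ⟨ENNReal.ofReal_pos.2 (by positivity), ENNReal.ofReal_lt_top⟩
    · rintro ⟨hL0, hL⟩
      have hl : 0 < L.toReal := ENNReal.toReal_pos hL0.ne' hL.ne
      -- `V = 1/2` lies in the half-plane for either sign of `s`; `W` is then chosen so that `V W =
      -- (L / k)²`.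
      have hden : 0 < 1 - s * (1 / 2) := by rcases h.sign_eq with rfl | rfl <;> norm_num
      let w := 2 * (L.toReal / AffPlus.scale A s) ^ 2
      have hw : 0 < w := by positivity
      let q : AffPlus := ⟨AffPlus.IsFlat.ofNull A s (1 / 2) w, inv_pos.2 hden⟩
      have hV : AffPlus.nullV s q.1 = 1 / 2 := h.nullV_ofNull _ _
      have hW : AffPlus.nullW A s q.1 = w := h.nullW_ofNull _ _
      have hV0 : 0 < AffPlus.nullV s q.1 := by rw [hV]; norm_num
      have hW0 : 0 < AffPlus.nullW A s q.1 := by rwa [hW]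
      refine ⟨q, ⟨hV0, hW0⟩, ?_⟩
      rw [h.lorentzDist_eq q hV0 hW0, hV, hW,
        show 1 / 2 * w = (L.toReal / AffPlus.scale A s) ^ 2 by simp only [w]; ring,
        Real.sqrt_sq (by positivity), mul_div_cancel₀ _ hk.ne', ENNReal.ofReal_toReal hL.ne]
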